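/- Let $C',D'\subset\mathbb N$ be infinite sets. Then there are infinite sets $C\subset C'$ and $D\subset D'$, a standard infinite measure space $(X,\mu)$ (a standard Borel space with a $\sigma$-finite non-atomic measure, $\mu(X)=\infty$) and two ergodic rank-one automorphisms $\bar S,\bar T$ of $(X,\mu)$ (invertible, bi-measurable, $\mu$-preserving) such that, denoting by the same letters the Koopman operators $\bar Sf=f\circ\bar S$, $\bar Tf=f\circ\bar T$ on $L_2(X,\mu)$, $$\bar S^i\to 0\quad\text{and}\quad \bar T^i\to I\qquad (i\to\infty,\ i\in C),$$ $$\bar S^i\to I\quad\text{and}\quad \bar T^i\to 0\qquad (i\to\infty,\ i\in D).$$ Here convergence to the identity operator $I$ is in the strong operator topology and convergence to $0$ is in the weak operator topology. An automorphism $T$ of $(X,\mu)$ has rank one if there are measurable sets $E_j$ of finite measure and integers $h_j\ge 0$ such that for every $j$ the sets $E_j,TE_j,\dots,T^{h_j-1}E_j$ are pairwise disjoint and, for every measurable $A\subset X$ with $\mu(A)<\infty$ and every $\varepsilon>0$, for all large $j$ there is a union $B$ of some of these sets with $\mu(A\,\triangle\,B)<\varepsilon$. -/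

import Mathlib

open MeasureTheory Filter Topology
open scoped ENNReal symmDiff

/-- The Koopman operator `f ↦ f ∘ T` on `L²(X, μ)` of a measure-preserving map `T`. -/
noncomputable def koopman {X : Type*} [MeasurableSpace X] {μ : Measure X} {T : X → X}
    (hT : MeasurePreserving T μ μ) : Lp ℂ 2 μ →ₗᵢ[ℂ] Lp ℂ 2 μ :=
  Lp.compMeasurePreservingₗᵢ ℂ T hT

/-- `i → ∞` along the set `P ⊆ ℕ`. -/
def along (P : Set ℕ) : Filter ℕ := atTop ⊓ 𝓟 P

/-- `U ^ i → 0` in the weak operator topology as `i → ∞`, `i ∈ P`. -/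
def PowTendstoZeroAlong {H : Type*} [NormedAddCommGroup H] [InnerProductSpace ℂ H]
    (U : H →ₗᵢ[ℂ] H) (P : Set ℕ) : Prop :=
  ∀ f g : H, Tendsto (fun i : ℕ => inner ℂ ((U ^ i) f) g) (along P) (𝓝 0)

/-- `U ^ i → I` in the strong operator topology as `i → ∞`, `i ∈ P`. -/
def PowTendstoIdAlong {H : Type*} [NormedAddCommGroup H] [InnerProductSpace ℂ H]
    (U : H →ₗᵢ[ℂ] H) (P : Set ℕ) : Prop :=
  ∀ f : H, Tendsto (fun i : ℕ => (U ^ i) f) (along P) (𝓝 f)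

/-- Rank one: there are Rokhlin towers `E j, T (E j), …, T ^ (h j - 1) (E j)` with pairwise disjoint
levels of finite measure such that every measurable set of finite measure is approximated, with any
prescribed accuracy and for all large `j`, by unions of levels of the `j`-th tower. -/
def IsRankOne {X : Type*} [MeasurableSpace X] (T : X ≃ᵐ X) (μ : Measure X) : Prop :=
  ∃ (E : ℕ → Set X) (h : ℕ → ℕ),
    (∀ j, MeasurableSet (E j) ∧ μ (E j) < ∞) ∧
    (∀ j, ∀ k < h j, ∀ l < h j, k ≠ l → Disjoint ((⇑T)^[k] '' E j) ((⇑T)^[l] '' E j)) ∧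
    ∀ A : Set X, MeasurableSet A → μ A < ∞ → ∀ ε : ℝ≥0∞, 0 < ε →
      ∀ᶠ j in atTop, ∃ I : Finset ℕ, I ⊆ Finset.range (h j) ∧
        μ (A ∆ ⋃ i ∈ I, (⇑T)^[i] '' E j) < ε

/-! ### Rank-one automorphisms are ergodic -/

section RankOneErgodic

/-! Both automorphisms are rank-one cutting-and-stacking maps of the line with Lebesgue measure. The
`j`-th tower has `2 * N j` levels; each level is cut into `r j` pieces, and the resulting columns
sit in the next tower at offsets `0, a j, 2 * a j, …`, with new cells of the line as spacers between
them.

Rigidity: the `a j`-th power carries each column to the next one, so it returns a union of levels to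
itself up to a proportion `1 / r j`, and `r j → ∞` (`volume_cells_diff_preimage_le`). Mixing: if `m
+ l * a j` has modulus at least `2 * N j` whenever `|l| < r j`, no column moved by `m` positions
meets another, so the `m`-th power throws the whole `j`-th tower off itself (`pos_iterate_notMem`).
Unions of levels approximate all sets of finite measure, and indicators span a dense subspace of L²,
which gives convergence of the operators.

These demands are compatible with exchanging roles: if `2 * N j ≤ c j` and `d j` is much larger than
`r j * c j`, then `a = c, m = d` and `a = d, m = c` are both admissible (`exists_interlaced_times`).
Infinite `C'` and `D'` contain such large times. Ergodicity follows from rank one alone. -/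

theorem iterate_image_inter_of_preimage_eq {X : Type*} {f : X → X} {A : Set X} (hA : f ⁻¹' A = A)
    (n : ℕ) (s : Set X) : f^[n] '' s ∩ A = f^[n] '' (s ∩ A) := by
  have h : f^[n] ⁻¹' A = A := by
    induction n with
    | zero => rfl
    | succ n ih => rw [Function.iterate_succ, Set.preimage_comp, ih, hA]
  conv_rhs => rw [← h]
  rw [Set.image_inter_preimage]

variable {X : Type*} [MeasurableSpace X] {μ : Measure X}

theorem MeasurableEmbedding.iterate_self {f : X → X} (hf : MeasurableEmbedding f) (n : ℕ) :
    MeasurableEmbedding f^[n] := by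
  induction n with
  | zero => exact MeasurableEmbedding.id
  | succ n ih => rw [Function.iterate_succ]; exact ih.comp hf

theorem MeasurableEquiv.measure_iterate_image {T : X ≃ᵐ X} (hT : MeasurePreserving T μ μ) (n : ℕ)
    {s : Set X} (hs : MeasurableSet s) : μ ((⇑T)^[n] '' s) = μ s := by
  have hm := T.measurableEmbedding.iterate_self n
  rw [← (hT.iterate n).measure_preimage (hm.measurableSet_image.2 hs).nullMeasurableSet,
    Set.preimage_image_eq _ hm.injective]

/-- If an invariant set `A` has positive measure, then it fills more than half of the base of every
sufficiently high tower. -/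
theorem eventually_measure_base_diff_lt [SigmaFinite μ] {T : X ≃ᵐ X}
    (hT : MeasurePreserving T μ μ) {E : ℕ → Set X} {h : ℕ → ℕ}
    (hE : ∀ j, MeasurableSet (E j) ∧ μ (E j) < ∞)
    (hdisj : ∀ j, ∀ k < h j, ∀ l < h j, k ≠ l →
      Disjoint ((⇑T)^[k] '' E j) ((⇑T)^[l] '' E j))
    (happ : ∀ A : Set X, MeasurableSet A → μ A < ∞ → ∀ ε : ℝ≥0∞, 0 < ε →
      ∀ᶠ j in atTop, ∃ I : Finset ℕ, I ⊆ Finset.range (h j) ∧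
        μ (A ∆ ⋃ i ∈ I, (⇑T)^[i] '' E j) < ε)
    {A : Set X} (hA : MeasurableSet A) (hinv : T ⁻¹' A = A) (hpos : μ A ≠ 0) :
    ∀ᶠ j in atTop, μ (E j ∩ Aᶜ) < μ (E j ∩ A) := by
  obtain ⟨A₀, hA₀A, hA₀, hA₀pos, hA₀fin⟩ : ∃ t ⊆ A, MeasurableSet t ∧ 0 < μ t ∧ μ t < ∞ := by
    obtain ⟨t, ht, h1, h2, h3⟩ := Measure.exists_subset_measure_lt_top (μ := μ) hA
      (pos_iff_ne_zero.2 hpos)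
    exact ⟨t, h1, ht, h2, h3⟩
  have hinvc : T ⁻¹' Aᶜ = Aᶜ := by rw [Set.preimage_compl, hinv]
  filter_upwards [happ A₀ hA₀ hA₀fin (μ A₀ / 2) (ENNReal.half_pos hA₀pos.ne')] with j ⟨I, hI, hlt⟩
  by_contra! hle
  set B : Set X := ⋃ i ∈ I, (⇑T)^[i] '' E j with hB
  -- By invariance every level meets `s` in the same measure as the base, so the comparison assumed
  -- on the base passes to any union of levels.
  have hsum : ∀ s : Set X, MeasurableSet s → T ⁻¹' s = s →
      μ (B ∩ s) = ∑ i ∈ I, μ (E j ∩ s) := by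
    intro s hs hsinv
    rw [hB, Set.iUnion₂_inter, measure_biUnion_finset]
    · refine Finset.sum_congr rfl fun i _ => ?_
      rw [iterate_image_inter_of_preimage_eq hsinv,
        MeasurableEquiv.measure_iterate_image hT _ ((hE j).1.inter hs)]
    · intro a ha b hb hab
      exact (hdisj j a (Finset.mem_range.1 (hI ha)) b (Finset.mem_range.1 (hI hb)) hab).mono
        Set.inter_subset_left Set.inter_subset_left
    · intro i _
      exact ((T.measurableEmbedding.iterate_self i).measurableSet_image.2 (hE j).1).inter hs
  have h1 : μ (B ∩ A) ≤ μ (B ∩ Aᶜ) := by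
    rw [hsum A hA hinv, hsum Aᶜ hA.compl hinvc]
    exact Finset.sum_le_sum fun _ _ => hle
  have h2 : μ (B ∩ Aᶜ) < μ A₀ / 2 := by
    refine lt_of_le_of_lt (measure_mono ?_) hlt
    rintro x ⟨hxB, hxA⟩
    exact Or.inr ⟨hxB, fun hx => hxA (hA₀A hx)⟩
  have h3 : μ A₀ ≤ μ (A₀ \ B) + μ (B ∩ A) := by
    refine (measure_mono ?_).trans (measure_union_le _ _)
    intro x hx
    by_cases hxB : x ∈ B
    · exact Or.inr ⟨hxB, hA₀A hx⟩
    · exact Or.inl ⟨hx, hxB⟩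
  have h4 : μ (A₀ \ B) < μ A₀ / 2 :=
    lt_of_le_of_lt (measure_mono Set.subset_union_left) hlt
  have h5 : μ A₀ < μ A₀ / 2 + μ A₀ / 2 :=
    h3.trans_lt (ENNReal.add_lt_add h4 (h1.trans_lt h2))
  rw [ENNReal.add_halves] at h5
  exact lt_irrefl _ h5

/-- If an invariant set and its complement both had positive measure, each would fill more than half
of the base of the same high tower. -/
theorem IsRankOne.ergodic [SigmaFinite μ] {T : X ≃ᵐ X} (hT : MeasurePreserving T μ μ)
    (h : IsRankOne T μ) : Ergodic T μ := by
  obtain ⟨E, h, hE, hdisj, happ⟩ := h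
  refine ⟨hT, ⟨fun A hA hinv => ?_⟩⟩
  rw [eventuallyConst_set']
  by_contra! hne
  have h1 := eventually_measure_base_diff_lt hT hE hdisj happ hA hinv
    (fun h0 => hne.1 (ae_eq_empty.2 h0))
  have h2 := eventually_measure_base_diff_lt hT hE hdisj happ hA.compl
    (by rw [Set.preimage_compl, hinv]) (fun h0 => hne.2 (ae_eq_univ.2 h0))
  obtain ⟨j, hj1, hj2⟩ := (h1.and h2).exists
  rw [compl_compl] at hj2
  exact lt_asymm hj1 hj2

end RankOneErgodic

/-! ### Convergence of powers of Koopman operators -/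

section Koopman

/-- A three-epsilon argument: the Lipschitz constant is common to all `Φ i`. It reduces convergence
on L² to indicators, since powers of an isometry are uniformly Lipschitz. -/
theorem isClosed_setOf_tendsto_of_lipschitzWith {ι E F : Type*} [PseudoMetricSpace E]
    [PseudoMetricSpace F] {Φ : ι → E → F} {Ψ : E → F} {K : NNReal}
    (hΦ : ∀ i, LipschitzWith K (Φ i)) (hΨ : LipschitzWith K Ψ) (l : Filter ι) :
    IsClosed {x | Tendsto (Φ · x) l (𝓝 (Ψ x))} := by
  refine isClosed_of_closure_subset fun x hx => Metric.tendsto_nhds.2 fun ε hε => ?_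
  -- The denominator has `K + 1` rather than `K` because `K` may vanish.
  obtain ⟨y, hy, hxy⟩ := Metric.mem_closure_iff.1 hx (ε / (3 * (K + 1))) (by positivity)
  have hK : K * dist x y ≤ ε / 3 := by
    calc K * dist x y ≤ (K + 1) * (ε / (3 * (K + 1))) := by gcongr; linarith
      _ = ε / 3 := by field_simp
  filter_upwards [Metric.tendsto_nhds.1 hy (ε / 3) (by positivity)] with i hi
  have h1 := (hΦ i).dist_le_mul x y
  have h2 := hΨ.dist_le_mul y x
  rw [dist_comm y x] at h2
  have h3 := dist_triangle4 (Φ i x) (Φ i y) (Ψ y) (Ψ x)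
  linarith

variable {X : Type*} [MeasurableSpace X] {μ : Measure X}

theorem koopman_pow_indicatorConstLp {T : X → X} (hT : MeasurePreserving T μ μ) (n : ℕ)
    {A : Set X} (hA : MeasurableSet A) (hμA : μ A ≠ ∞) (c : ℂ) :
    (koopman hT ^ n) (indicatorConstLp 2 hA hμA c) =
      indicatorConstLp 2 ((hT.iterate n).measurable hA)
        (by rwa [(hT.iterate n).measure_preimage hA.nullMeasurableSet]) c := by
  induction n with
  | zero => rfl
  | succ n ih =>
    rw [pow_succ']
    change koopman hT ((koopman hT ^ n) _) = _
    rw [ih]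
    rfl

theorem inner_koopman_pow_indicatorConstLp {T : X → X} (hT : MeasurePreserving T μ μ) (n : ℕ)
    {A B : Set X} (hA : MeasurableSet A) (hμA : μ A ≠ ∞) (hB : MeasurableSet B) (hμB : μ B ≠ ∞)
    (a b : ℂ) :
    inner ℂ ((koopman hT ^ n) (indicatorConstLp 2 hA hμA a)) (indicatorConstLp 2 hB hμB b) =
      μ.real (T^[n] ⁻¹' A ∩ B) • inner ℂ a b := by
  rw [koopman_pow_indicatorConstLp, L2.inner_indicatorConstLp_indicatorConstLp _ _ _ hμB]

theorem powTendstoZeroAlong_koopman {T : X → X} (hT : MeasurePreserving T μ μ) {P : Set ℕ}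
    (h : ∀ A B : Set X, MeasurableSet A → μ A ≠ ∞ → MeasurableSet B → μ B ≠ ∞ →
      Tendsto (fun n => μ.real (T^[n] ⁻¹' A ∩ B)) (along P) (𝓝 0)) :
    PowTendstoZeroAlong (koopman hT) P := by
  intro f g
  refine Lp.induction (by simp) (motive := fun f => Tendsto
    (fun i : ℕ => inner ℂ ((koopman hT ^ i) f) g) (along P) (𝓝 0)) ?_ ?_ ?_ f
  · intro a A hA hμA
    refine Lp.induction (by simp) (motive := fun g => Tendsto (fun i : ℕ => inner ℂ
      ((koopman hT ^ i) (Lp.simpleFunc.indicatorConst 2 hA hμA.ne a)) g) (along P) (𝓝 0))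
      ?_ ?_ ?_ g
    · intro b B hB hμB
      rw [Lp.simpleFunc.coe_indicatorConst, Lp.simpleFunc.coe_indicatorConst]
      simp_rw [inner_koopman_pow_indicatorConstLp hT _ hA hμA.ne hB hμB.ne]
      simpa using (h A B hA hμA.ne hB hμB.ne).smul_const (inner ℂ a b)
    · intro f g hf hg _ h1 h2
      simp_rw [inner_add_right]
      simpa using h1.add h2
    · refine isClosed_setOf_tendsto_of_lipschitzWith (Ψ := fun _ => (0 : ℂ))
        (K := ‖(Lp.simpleFunc.indicatorConst 2 hA hμA.ne a : Lp ℂ 2 μ)‖₊)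
        (fun i => ?_) (LipschitzWith.const' _) _
      refine LipschitzWith.of_dist_le_mul fun x y => ?_
      rw [dist_eq_norm, dist_eq_norm, ← inner_sub_right]
      refine (norm_inner_le_norm _ _).trans (le_of_eq ?_)
      rw [LinearIsometry.norm_map, coe_nnnorm]
  · intro f g hf hg _ h1 h2
    simp_rw [map_add, inner_add_left]
    simpa using h1.add h2
  · refine isClosed_setOf_tendsto_of_lipschitzWith (Ψ := fun _ => (0 : ℂ)) (K := ‖g‖₊)
      (fun i => ?_) (LipschitzWith.const' _) _
    refine LipschitzWith.of_dist_le_mul fun x y => ?_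
    rw [dist_eq_norm, dist_eq_norm, ← inner_sub_left, ← map_sub]
    refine (norm_inner_le_norm _ _).trans (le_of_eq ?_)
    rw [LinearIsometry.norm_map, coe_nnnorm, mul_comm]

theorem powTendstoIdAlong_koopman {T : X → X} (hT : MeasurePreserving T μ μ) {P : Set ℕ}
    (h : ∀ A : Set X, MeasurableSet A → μ A ≠ ∞ →
      Tendsto (fun n => μ.real (A \ T^[n] ⁻¹' A)) (along P) (𝓝 0)) :
    PowTendstoIdAlong (koopman hT) P := by
  intro f
  refine Lp.induction (by simp) (motive := fun f => Tendsto
    (fun i : ℕ => (koopman hT ^ i) f) (along P) (𝓝 f)) ?_ ?_ ?_ f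
  · intro a A hA hμA
    rw [Lp.simpleFunc.coe_indicatorConst, tendsto_iff_norm_sub_tendsto_zero]
    set f := indicatorConstLp 2 hA hμA.ne a with hf
    -- Expand the square: both norms equal `‖f‖` and the cross term is the measure of the overlap of
    -- `A` with its preimage.
    have key : ∀ i : ℕ, ‖(koopman hT ^ i) f - f‖ ^ 2 =
        2 * ‖a‖ ^ 2 * μ.real (A \ T^[i] ⁻¹' A) := by
      intro i
      have h1 : ‖f‖ ^ 2 = μ.real A * ‖a‖ ^ 2 := by
        have := inner_self_eq_norm_sq_to_K (𝕜 := ℂ) f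
        rw [hf, L2.inner_indicatorConstLp_indicatorConstLp, inner_self_eq_norm_sq_to_K,
          Set.inter_self] at this
        rw [hf]
        simp only [Complex.real_smul, Complex.coe_algebraMap] at this
        exact_mod_cast this.symm
      have h2 := congrArg Complex.re
        (inner_koopman_pow_indicatorConstLp hT i hA hμA.ne hA hμA.ne a a)
      rw [inner_self_eq_norm_sq_to_K, Complex.real_smul] at h2
      simp only [Complex.coe_algebraMap] at h2
      rw [← Complex.ofReal_pow, ← Complex.ofReal_mul, Complex.ofReal_re] at h2
      have h3 : μ.real (A \ T^[i] ⁻¹' A) = μ.real A - μ.real (T^[i] ⁻¹' A ∩ A) := by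
        have := measureReal_inter_add_sdiff (μ := μ) (s := A) (t := T^[i] ⁻¹' A)
          ((hT.iterate i).measurable hA) hμA.ne
        rw [Set.inter_comm] at this
        linarith
      have h4 := norm_sub_sq (𝕜 := ℂ) ((koopman hT ^ i) f) f
      rw [LinearIsometry.norm_map, h1] at h4
      rw [h4, h3]
      change _ - 2 * (inner ℂ ((koopman hT ^ i) f) f).re + _ = _
      rw [h2]
      ring
    have h5 : Tendsto (fun i : ℕ => ‖(koopman hT ^ i) f - f‖ ^ 2) (along P) (𝓝 0) := by
      simp_rw [key]
      simpa using (h A hA hμA.ne).const_mul (2 * ‖a‖ ^ 2)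
    have h6 := h5.sqrt
    simpa [Real.sqrt_sq] using h6
  · intro f g hf hg _ h1 h2
    simp_rw [map_add]
    exact h1.add h2
  · exact isClosed_setOf_tendsto_of_lipschitzWith (fun i => (koopman hT ^ i).lipschitz)
      LipschitzWith.id _

theorem tendsto_along_range {α : Type*} {u : ℕ → α} {a : ℕ → ℕ} (ha : StrictMono a)
    {l : Filter α} (h : Tendsto (fun j => u (a j)) atTop l) :
    Tendsto u (along (Set.range a)) l := by
  intro s hs
  obtain ⟨J, hJ⟩ := eventually_atTop.1 (h hs)
  rw [mem_map, along, mem_inf_principal]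
  filter_upwards [eventually_ge_atTop (a J)] with i hi hia
  obtain ⟨j, rfl⟩ := hia
  exact hJ j (ha.le_iff_le.1 hi)

end Koopman

/-! ### Interval exchanges permuting the cells of a grid on the line -/

section Grid

/-- The index of the cell `[k / R, (k + 1) / R)` containing `x`. -/
noncomputable def cellIndex (R : ℕ) (x : ℝ) : ℤ := ⌊x * R⌋

/-- The piecewise translation of `ℝ` that moves the `k`-th cell of length `1 / R` onto the
`τ k`-th one. -/
noncomputable def permuteCells (R : ℕ) (τ : Equiv.Perm ℤ) (x : ℝ) : ℝ :=
  x + ((τ (cellIndex R x) - cellIndex R x : ℤ) : ℝ) / R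

theorem measurable_cellIndex (R : ℕ) : Measurable (cellIndex R) :=
  Int.measurable_floor.comp (measurable_id.mul_const _)

theorem measurable_permuteCells (R : ℕ) (τ : Equiv.Perm ℤ) : Measurable (permuteCells R τ) := by
  have h : Measurable fun k : ℤ => ((τ k - k : ℤ) : ℝ) / R := measurable_from_top
  exact measurable_id.add (h.comp (measurable_cellIndex R))

variable {R : ℕ}

theorem cellIndex_permuteCells (hR : 0 < R) (τ : Equiv.Perm ℤ) (x : ℝ) :
    cellIndex R (permuteCells R τ x) = τ (cellIndex R x) := by
  have hR' : (R : ℝ) ≠ 0 := by positivity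
  have h : permuteCells R τ x * R = x * R + ((τ (cellIndex R x) - cellIndex R x : ℤ) : ℝ) := by
    rw [permuteCells]; field_simp
  rw [cellIndex, h, Int.floor_add_intCast]
  simp [cellIndex]

theorem permuteCells_mul (hR : 0 < R) (τ σ : Equiv.Perm ℤ) (x : ℝ) :
    permuteCells R (τ * σ) x = permuteCells R τ (permuteCells R σ x) := by
  rw [permuteCells, permuteCells, cellIndex_permuteCells hR, permuteCells, Equiv.Perm.mul_apply]
  push_cast
  ring

theorem permuteCells_one (x : ℝ) : permuteCells R 1 x = x := by simp [permuteCells]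

theorem cellIndex_preimage_singleton (hR : 0 < R) (k : ℤ) :
    cellIndex R ⁻¹' {k} = Set.Ico ((k : ℝ) / R) ((k + 1) / R) := by
  have hR' : (0 : ℝ) < R := by positivity
  ext x
  simp only [Set.mem_preimage, Set.mem_singleton_iff, cellIndex, Int.floor_eq_iff, Set.mem_Ico,
    div_le_iff₀ hR', lt_div_iff₀ hR']

theorem volume_cellIndex_preimage_singleton (hR : 0 < R) (k : ℤ) :
    volume (cellIndex R ⁻¹' {k}) = ENNReal.ofReal (1 / R) := by
  rw [cellIndex_preimage_singleton hR, Real.volume_Ico]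
  congr 1
  ring

theorem abs_sub_lt_of_cellIndex_eq (hR : 0 < R) {x y : ℝ} (h : cellIndex R x = cellIndex R y) :
    |x - y| < 1 / R := by
  have hR' : (0 : ℝ) < R := by positivity
  have h1 := Int.abs_sub_lt_one_of_floor_eq_floor h
  rw [← sub_mul, abs_mul, abs_of_pos hR'] at h1
  rwa [lt_div_iff₀ hR']

theorem volume_eq_tsum_inter_cell (R : ℕ) {A : Set ℝ} (hA : MeasurableSet A) :
    volume A = ∑' k : ℤ, volume (A ∩ cellIndex R ⁻¹' {k}) := by
  rw [← measure_iUnion]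
  · rw [← Set.inter_iUnion, ← Set.preimage_iUnion, Set.iUnion_of_singleton, Set.preimage_univ,
      Set.inter_univ]
  · intro a b hab
    exact ((Set.disjoint_singleton.2 hab).preimage _).mono Set.inter_subset_right
      Set.inter_subset_right
  · exact fun k => hA.inter (measurable_cellIndex R (measurableSet_singleton k))

/-- On each cell the map is a translation, so the measures agree cell by cell after reindexing the
sum by `τ`. -/
theorem measurePreserving_permuteCells (hR : 0 < R) (τ : Equiv.Perm ℤ) :
    MeasurePreserving (permuteCells R τ) volume volume := by
  refine ⟨measurable_permuteCells R τ, Measure.ext fun A hA => ?_⟩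
  rw [Measure.map_apply (measurable_permuteCells R τ) hA,
    volume_eq_tsum_inter_cell R (measurable_permuteCells R τ hA), volume_eq_tsum_inter_cell R hA,
    ← Equiv.tsum_eq τ fun k => volume (A ∩ cellIndex R ⁻¹' {k})]
  refine tsum_congr fun k => ?_
  rw [← measure_preimage_add_right volume (((τ k - k : ℤ) : ℝ) / R)
    (A ∩ cellIndex R ⁻¹' {τ k})]
  congr 1
  ext x
  have hR' : (R : ℝ) ≠ 0 := by positivity
  have h : (x + ((τ k - k : ℤ) : ℝ) / R) * R = x * R + ((τ k - k : ℤ) : ℝ) := by field_simp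
  have h2 : cellIndex R (x + ((τ k - k : ℤ) : ℝ) / R) = τ k ↔ cellIndex R x = k := by
    rw [cellIndex, h, Int.floor_add_intCast, cellIndex]
    omega
  simp only [Set.mem_inter_iff, Set.mem_preimage, Set.mem_singleton_iff, h2]
  refine and_congr_left fun hk => ?_
  rw [permuteCells, hk]

theorem cellIndex_mul_ediv {r : ℕ} (hr : 0 < r) (x : ℝ) :
    cellIndex (R * r) x / r = cellIndex R x := by
  have hr' : (r : ℝ) ≠ 0 := by positivity
  rw [cellIndex, cellIndex, ← Int.floor_div_natCast]
  congr 1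
  push_cast
  field_simp

theorem permuteCells_refine (hR : 0 < R) {r : ℕ} (hr : 0 < r) {τ σ : Equiv.Perm ℤ} {x : ℝ}
    (h : σ (cellIndex (R * r) x) - cellIndex (R * r) x =
      r * (τ (cellIndex R x) - cellIndex R x)) :
    permuteCells (R * r) σ x = permuteCells R τ x := by
  have hr' : (r : ℝ) ≠ 0 := by positivity
  have hR' : (R : ℝ) ≠ 0 := by positivity
  rw [permuteCells, permuteCells, h]
  push_cast
  field_simp

end Grid

/-! ### Eventually constant limits of measure-preserving maps -/

section EventualLimit

variable {X : Type*} [MeasurableSpace X] {μ : Measure X}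

/-- A Fatou-type bound: the preimage lies in the increasing union of the tail intersections of the
`φ j ⁻¹' A`. The reverse inequality will come from the same bound for the inverse map. -/
theorem measure_preimage_le_of_eventually_eq {φ : ℕ → X → X} {f : X → X}
    (hφ : ∀ j, MeasurePreserving (φ j) μ μ) (hf : ∀ x, ∀ᶠ j in atTop, f x = φ j x)
    {A : Set X} (hA : MeasurableSet A) : μ (f ⁻¹' A) ≤ μ A := by
  have h1 : f ⁻¹' A ⊆ ⋃ J : ℕ, ⋂ j ≥ J, φ j ⁻¹' A := by
    intro x hx
    obtain ⟨J, hJ⟩ := eventually_atTop.1 (hf x)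
    refine Set.mem_iUnion.2 ⟨J, Set.mem_iInter₂.2 fun j hj => ?_⟩
    change φ j x ∈ A
    rw [← hJ j hj]
    exact hx
  refine (measure_mono h1).trans ?_
  have hmono : Monotone fun J : ℕ => ⋂ j ≥ J, φ j ⁻¹' A := by
    intro J J' h x hx
    exact Set.mem_iInter₂.2 fun j hj => Set.mem_iInter₂.1 hx j (h.trans hj)
  rw [hmono.measure_iUnion]
  refine iSup_le fun J => ?_
  rw [← (hφ J).measure_preimage hA.nullMeasurableSet]
  exact measure_mono (Set.iInter₂_subset J le_rfl)

theorem measurable_of_eventually_eq {φ : ℕ → X → X} {f : X → X}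
    (hφ : ∀ j, Measurable (φ j)) (hf : ∀ x, ∀ᶠ j in atTop, f x = φ j x) : Measurable f := by
  intro A hA
  have h : f ⁻¹' A = ⋃ J : ℕ, ⋂ j ≥ J, φ j ⁻¹' A := by
    ext x
    obtain ⟨J, hJ⟩ := eventually_atTop.1 (hf x)
    simp only [Set.mem_preimage, Set.mem_iUnion, Set.mem_iInter]
    constructor
    · exact fun hx => ⟨J, fun j hj => hJ j hj ▸ hx⟩
    · rintro ⟨J', hJ'⟩
      rw [hJ _ (le_max_left J J')]
      exact hJ' _ (le_max_right J J')
  rw [h]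
  exact MeasurableSet.iUnion fun J => MeasurableSet.iInter fun j => MeasurableSet.iInter fun _ =>
    hφ j hA

/-- An eventually constant pointwise limit of invertible measure-preserving maps, whose inverses
are also eventually constant, is an invertible measure-preserving map. -/
theorem exists_measurableEquiv_eventually_eq {φ ψ : ℕ → X → X}
    (hφ : ∀ j, MeasurePreserving (φ j) μ μ) (hψ : ∀ j, MeasurePreserving (ψ j) μ μ)
    (hφψ : ∀ j x, φ j (ψ j x) = x) (hψφ : ∀ j x, ψ j (φ j x) = x)
    (hφc : ∀ x, ∃ J, ∀ j ≥ J, φ j x = φ J x) (hψc : ∀ x, ∃ J, ∀ j ≥ J, ψ j x = ψ J x) :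
    ∃ T : X ≃ᵐ X, MeasurePreserving T μ μ ∧ ∀ x, ∀ᶠ j in atTop, T x = φ j x := by
  choose J hJ using hφc
  choose K hK using hψc
  have hf : ∀ x, ∀ᶠ j in atTop, φ (J x) x = φ j x := fun x =>
    eventually_atTop.2 ⟨J x, fun j hj => (hJ x j hj).symm⟩
  have hg : ∀ x, ∀ᶠ j in atTop, ψ (K x) x = ψ j x := fun x =>
    eventually_atTop.2 ⟨K x, fun j hj => (hK x j hj).symm⟩
  have hfm := measurable_of_eventually_eq (fun j => (hφ j).measurable) hf
  have hgm := measurable_of_eventually_eq (fun j => (hψ j).measurable) hg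
  let T : X ≃ᵐ X :=
    { toFun := fun x => φ (J x) x
      invFun := fun x => ψ (K x) x
      left_inv := fun x => by
        obtain ⟨j, h1, h2⟩ := ((hf x).and (hg (φ (J x) x))).exists
        change ψ _ (φ _ _) = _
        rw [h2, h1, hψφ]
      right_inv := fun x => by
        obtain ⟨j, h1, h2⟩ := ((hg x).and (hf (ψ (K x) x))).exists
        change φ _ (ψ _ _) = _
        rw [h2, h1, hφψ]
      measurable_toFun := hfm
      measurable_invFun := hgm }
  refine ⟨T, ⟨T.measurable, Measure.ext fun A hA => ?_⟩, hf⟩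
  rw [Measure.map_apply T.measurable hA]
  refine le_antisymm (measure_preimage_le_of_eventually_eq hφ hf hA) ?_
  calc μ A = μ (T.symm ⁻¹' (T ⁻¹' A)) := by
        rw [← Set.preimage_comp, MeasurableEquiv.self_comp_symm, Set.preimage_id]
    _ ≤ μ (T ⁻¹' A) := measure_preimage_le_of_eventually_eq hψ hg (T.measurable hA)

end EventualLimit

/-! ### Permutations with prescribed values on a finite set -/

theorem Finset.exists_perm_extend {α : Type*} [DecidableEq α] {s t : Finset α} (hst : s ⊆ t)
    {f : α → α} (hf : ∀ x ∈ s, f x ∈ t) (hinj : Set.InjOn f s) :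
    ∃ σ : Equiv.Perm α, (∀ x, σ x ∈ t ↔ x ∈ t) ∧ ∀ x ∈ s, σ x = f x := by
  obtain ⟨g, hg⟩ := Finset.exists_equiv_extend_of_card_eq (α := t) (t := t) (by simp)
    (s := s.subtype (· ∈ t)) (f := fun x => f x)
    (by
      intro y hy
      obtain ⟨x, hx, rfl⟩ := Finset.mem_image.1 hy
      exact hf x (Finset.mem_subtype.1 hx))
    (by
      intro x hx y hy hxy
      exact Subtype.ext (hinj (Finset.mem_subtype.1 hx) (Finset.mem_subtype.1 hy) hxy))
  have hmem : ∀ x (hx : x ∈ t), Equiv.Perm.ofSubtype (p := (· ∈ t)) g x = g ⟨x, hx⟩ :=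
    fun x hx => Equiv.Perm.ofSubtype_apply_of_mem (p := (· ∈ t)) g hx
  refine ⟨Equiv.Perm.ofSubtype (p := (· ∈ t)) g, fun x => ?_, fun x hx => ?_⟩
  · by_cases hx : x ∈ t
    · rw [hmem x hx]
      simp [hx]
    · rw [Equiv.Perm.ofSubtype_apply_of_not_mem (p := (· ∈ t)) g hx]
  · rw [hmem x (hst hx)]
    exact hg ⟨x, hst hx⟩ (Finset.mem_subtype.2 hx)

/-! ### Cutting and stacking on the line -/

/-- Combinatorial data of a rank-one construction on the line. The `j`-th tower consists of the
cells of length `1 / ∏ i < j, r i` with index in `[-N j, N j)`; the permutation `e j` sends the index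
of a cell to its position in the tower. Each level of the `j`-th tower is cut into `r j` pieces
and the resulting columns are placed in the next tower at distance `a j` from each other. -/
structure CuttingStacking where
  r : ℕ → ℕ
  N : ℕ → ℕ
  a : ℕ → ℕ
  e : ℕ → Equiv.Perm ℤ
  two_le_r : ∀ j, 2 ≤ r j
  lt_N : ∀ j, N j + r j * a j < N (j + 1)
  mul_prod_le_N : ∀ j, j * ∏ i ∈ Finset.range j, r i ≤ N j
  e_mem : ∀ j k, e j k ∈ Finset.Ico (-(N j : ℤ)) (N j) ↔ k ∈ Finset.Ico (-(N j : ℤ)) (N j)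
  e_succ : ∀ j, ∀ k ∈ Finset.Ico (-(N j : ℤ)) (N j), ∀ d : ℤ, 0 ≤ d → d < r j →
    e (j + 1) (r j * k + d) = e j k + d * a j

/-- The positions are built recursively: the placement of the columns is an injection on the pieces
of the old cells, and any extension to a permutation of the larger interval places the spacers. -/
theorem exists_cuttingStacking {r N a : ℕ → ℕ} (hr : ∀ j, 2 ≤ r j) (ha : ∀ j, 2 * N j ≤ a j)
    (hN : ∀ j, N j + r j * a j < N (j + 1))
    (hN' : ∀ j, j * ∏ i ∈ Finset.range j, r i ≤ N j) :
    ∃ c : CuttingStacking, c.r = r ∧ c.N = N ∧ c.a = a := by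
  let I : ℕ → Finset ℤ := fun j => Finset.Ico (-(N j : ℤ)) (N j)
  have step : ∀ j (σ : {σ : Equiv.Perm ℤ // ∀ k, σ k ∈ I j ↔ k ∈ I j}),
      ∃ σ' : {σ : Equiv.Perm ℤ // ∀ k, σ k ∈ I (j + 1) ↔ k ∈ I (j + 1)},
        ∀ k ∈ I j, ∀ d : ℤ, 0 ≤ d → d < r j →
          σ'.1 (r j * k + d) = σ.1 k + d * a j := by
    rintro j ⟨σ, hσ⟩
    have hrj : (2 : ℤ) ≤ r j := by exact_mod_cast hr j
    have haj : 2 * (N j : ℤ) ≤ a j := by exact_mod_cast ha j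
    have hNj : (N j : ℤ) + r j * a j < N (j + 1) := by exact_mod_cast hN j
    have hN0 : (0 : ℤ) ≤ N j := by positivity
    have hdm : ∀ k d : ℤ, 0 ≤ d → d < r j → (r j * k + d) / r j = k ∧ (r j * k + d) % r j = d := by
      intro k d hd hdr
      constructor
      · rw [add_comm, Int.add_mul_ediv_left _ _ (by omega), Int.ediv_eq_zero_of_lt hd hdr, zero_add]
      · rw [add_comm, Int.add_mul_emod_self_left, Int.emod_eq_of_lt hd hdr]
    have hs : ∀ k, k ∈ Finset.Ico (-(r j * N j : ℤ)) (r j * N j) → k / r j ∈ I j := by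
      intro k hk
      rw [Finset.mem_Ico] at hk ⊢
      constructor
      · rw [Int.le_ediv_iff_mul_le (by omega)]
        linarith [hk.1, mul_comm (r j : ℤ) (N j)]
      · rw [Int.ediv_lt_iff_lt_mul (by omega)]
        linarith [hk.2, mul_comm (r j : ℤ) (N j)]
    obtain ⟨τ, h1, h2⟩ := Finset.exists_perm_extend
      (s := Finset.Ico (-(r j * N j : ℤ)) (r j * N j)) (t := I (j + 1))
      (f := fun k => σ (k / r j) + (k % r j) * a j)
      (by
        have : (r j : ℤ) * N j ≤ r j * a j := by nlinarith
        refine Finset.Ico_subset_Ico ?_ ?_ <;> omega)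
      (by
        intro k hk
        have h3 := (hσ _).2 (hs k hk)
        have h4 := Int.emod_nonneg k (show (r j : ℤ) ≠ 0 by omega)
        have h5 := Int.emod_lt_of_pos k (show (0 : ℤ) < r j by omega)
        rw [Finset.mem_Ico] at h3 ⊢
        have h6 : 0 ≤ (k % r j) * (a j : ℤ) := by positivity
        have h7 : (k % r j) * (a j : ℤ) ≤ r j * a j := by gcongr
        constructor <;> omega)
      (by
        intro k hk l hl hkl
        have h3 := (hσ _).2 (hs k hk)
        have h4 := (hσ _).2 (hs l hl)
        rw [Finset.mem_Ico] at h3 h4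
        simp only at hkl
        -- Old positions differ by less than `2 * N j ≤ a j`, so they cannot compensate for
        -- different column numbers.
        have h5 : k % r j = l % r j := by
          rcases lt_trichotomy (k % r j) (l % r j) with h | h | h
          · nlinarith
          · exact h
          · nlinarith
        have h6 : k / r j = l / r j := by
          rw [h5] at hkl
          exact σ.injective (by linarith)
        rw [← Int.mul_ediv_add_emod k (r j), ← Int.mul_ediv_add_emod l (r j), h5, h6])
    refine ⟨⟨τ, h1⟩, fun k hk d hd hdr => ?_⟩
    obtain ⟨h3, h4⟩ := hdm k d hd hdr
    have h5 := h2 (r j * k + d) (by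
      rw [Finset.mem_Ico] at hk ⊢
      constructor <;> nlinarith)
    rw [h3, h4] at h5
    exact h5
  choose next hnext using step
  let e : ∀ j, {σ : Equiv.Perm ℤ // ∀ k, σ k ∈ I j ↔ k ∈ I j} :=
    fun j => Nat.rec ⟨1, fun _ => Iff.rfl⟩ next j
  exact ⟨⟨r, N, a, fun j => (e j).1, hr, hN, hN', fun j => (e j).2,
    fun j => hnext j (e j)⟩, rfl, rfl, rfl⟩

/-! ### Positions, shifts and the limiting automorphism -/

namespace CuttingStacking

variable (c : CuttingStacking)

/-- The number of cells per unit length at stage `j`. -/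
def scale (j : ℕ) : ℕ := ∏ i ∈ Finset.range j, c.r i

/-- The set of positions in the `j`-th tower. -/
noncomputable def positions (j : ℕ) : Finset ℤ := Finset.Ico (-(c.N j : ℤ)) (c.N j)

/-- The position of a point at stage `j`. -/
noncomputable def pos (j : ℕ) (x : ℝ) : ℤ := c.e j (cellIndex (c.scale j) x)

/-- The map moving every point by `s` positions at stage `j`. -/
noncomputable def shift (j : ℕ) (s : ℤ) : ℝ → ℝ :=
  permuteCells (c.scale j) ((c.e j)⁻¹ * Equiv.addRight s * c.e j)

theorem scale_succ (j : ℕ) : c.scale (j + 1) = c.scale j * c.r j := Finset.prod_range_succ _ _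

theorem r_pos (j : ℕ) : 0 < c.r j := two_pos.trans_le (c.two_le_r j)

theorem scale_pos (j : ℕ) : 0 < c.scale j := Finset.prod_pos fun i _ => c.r_pos i

theorem lt_scale (j : ℕ) : j < c.scale j := by
  induction j with
  | zero => exact c.scale_pos 0
  | succ j ih =>
    rw [scale_succ]
    nlinarith [c.two_le_r j]

theorem pos_mem {j : ℕ} {x : ℝ} :
    c.pos j x ∈ c.positions j ↔ cellIndex (c.scale j) x ∈ c.positions j := c.e_mem j _

theorem pos_shift (j : ℕ) (s : ℤ) (x : ℝ) : c.pos j (c.shift j s x) = c.pos j x + s := by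
  rw [pos, shift, cellIndex_permuteCells (c.scale_pos j)]
  simp [pos]

theorem shift_shift (j : ℕ) (s t : ℤ) (x : ℝ) :
    c.shift j s (c.shift j t x) = c.shift j (s + t) x := by
  rw [shift, shift, ← permuteCells_mul (c.scale_pos j), shift]
  congr 1
  ext k
  simp [add_comm s t, add_assoc]

theorem shift_zero (j : ℕ) (x : ℝ) : c.shift j 0 x = x := by
  have h : (c.e j)⁻¹ * Equiv.addRight 0 * c.e j = 1 := by ext; simp
  rw [shift, h, permuteCells_one]

theorem measurePreserving_shift (j : ℕ) (s : ℤ) :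
    MeasurePreserving (c.shift j s) volume volume :=
  measurePreserving_permuteCells (c.scale_pos j) _

theorem exists_digit (j : ℕ) (x : ℝ) : ∃ d : ℤ, 0 ≤ d ∧ d < c.r j ∧
    cellIndex (c.scale (j + 1)) x = c.r j * cellIndex (c.scale j) x + d := by
  have hr : (0 : ℤ) < c.r j := by exact_mod_cast c.r_pos j
  refine ⟨cellIndex (c.scale (j + 1)) x % c.r j, Int.emod_nonneg _ hr.ne',
    Int.emod_lt_of_pos _ hr, ?_⟩
  rw [← cellIndex_mul_ediv (R := c.scale j) (c.r_pos j), ← scale_succ, Int.mul_ediv_add_emod]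

theorem pos_succ {j : ℕ} {x : ℝ} (hx : c.pos j x ∈ c.positions j) {d : ℤ} (hd : 0 ≤ d)
    (hdr : d < c.r j)
    (hxd : cellIndex (c.scale (j + 1)) x = c.r j * cellIndex (c.scale j) x + d) :
    c.pos (j + 1) x = c.pos j x + d * c.a j := by
  rw [pos, hxd, c.e_succ j _ (c.pos_mem.1 hx) d hd hdr, pos]

/-- A move that stays inside the `j`-th tower stays in one column of the next tower, so refining the
tower does not change it. -/
theorem shift_succ {j : ℕ} {x : ℝ} {s : ℤ} (hx : c.pos j x ∈ c.positions j)
    (hxs : c.pos j x + s ∈ c.positions j) : c.shift (j + 1) s x = c.shift j s x := by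
  obtain ⟨d, hd, hdr, hxd⟩ := c.exists_digit j x
  rw [shift, scale_succ]
  refine permuteCells_refine (c.scale_pos j) (c.r_pos j) ?_
  rw [← scale_succ]
  -- `k` is the target cell at stage `j`; its piece with the same digit `d` is the target at stage
  -- `j + 1`.
  set k := (c.e j).symm (c.pos j x + s) with hk
  have hek : c.e j k = c.pos j x + s := Equiv.apply_symm_apply _ _
  have hkI : k ∈ c.positions j := (c.e_mem j k).1 (by rw [hek]; exact hxs)
  have h1 : c.e (j + 1) (c.r j * k + d) = c.pos (j + 1) x + s := by
    rw [c.e_succ j k hkI d hd hdr, hek, c.pos_succ hx hd hdr hxd]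
    ring
  have h2 : (c.e (j + 1)).symm (c.pos (j + 1) x + s) = c.r j * k + d := by
    rw [← h1, Equiv.symm_apply_apply]
  change (c.e (j + 1)).symm (c.pos (j + 1) x + s) - _ = c.r j * (k - _)
  rw [h2, hxd]
  ring

/-- The strict inequality `lt_N` leaves room at both ends of the next tower, so later moves by one
position never leave a tower. -/
theorem pos_mem_interior {i j : ℕ} (hij : j < i) {x : ℝ} (hx : c.pos j x ∈ c.positions j) :
    -(c.N i : ℤ) < c.pos i x ∧ c.pos i x + 1 < c.N i := by
  have step : ∀ j, c.pos j x ∈ c.positions j →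
      -(c.N (j + 1) : ℤ) < c.pos (j + 1) x ∧ c.pos (j + 1) x + 1 < c.N (j + 1) := by
    intro j hx
    obtain ⟨d, hd, hdr, hxd⟩ := c.exists_digit j x
    have h1 := c.pos_succ hx hd hdr hxd
    have h2 : (c.N j : ℤ) + c.r j * c.a j < c.N (j + 1) := by exact_mod_cast c.lt_N j
    have h3 : 0 ≤ d * (c.a j : ℤ) := by positivity
    have h4 : d * (c.a j : ℤ) ≤ c.r j * c.a j := by gcongr
    rw [positions, Finset.mem_Ico] at hx
    omega
  induction i, hij using Nat.le_induction with
  | base => exact step j hx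
  | succ i _ ih =>
    refine step i ?_
    rw [positions, Finset.mem_Ico]
    omega

theorem pos_mem_of_le {i j : ℕ} (hij : j ≤ i) {x : ℝ} (hx : c.pos j x ∈ c.positions j) :
    c.pos i x ∈ c.positions i := by
  rcases hij.eq_or_lt with rfl | hij
  · exact hx
  · have := c.pos_mem_interior hij hx
    rw [positions, Finset.mem_Ico]
    omega

theorem pos_mem_of_abs_lt {j : ℕ} {x : ℝ} (hx : |x| < j) : c.pos j x ∈ c.positions j := by
  rw [pos_mem, positions, Finset.mem_Ico, cellIndex]
  have h0 : (0 : ℝ) < c.scale j := by exact_mod_cast c.scale_pos j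
  have h1 : (j : ℝ) * c.scale j ≤ c.N j := by exact_mod_cast c.mul_prod_le_N j
  obtain ⟨h2, h3⟩ := abs_lt.1 hx
  constructor
  · rw [Int.le_floor]
    push_cast
    nlinarith
  · rw [Int.floor_lt]
    push_cast
    nlinarith

theorem eventually_pos_mem (x : ℝ) : ∀ᶠ j in atTop, c.pos j x ∈ c.positions j := by
  obtain ⟨J, hJ⟩ := exists_nat_gt |x|
  filter_upwards [eventually_ge_atTop J] with j hj
  exact c.pos_mem_of_abs_lt (hJ.trans_le (by exact_mod_cast hj))

theorem exists_shift_eventually_const (x : ℝ) {s : ℤ} (hs : -1 ≤ s) (hs' : s ≤ 1) :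
    ∃ J, ∀ j ≥ J, c.shift j s x = c.shift J s x := by
  obtain ⟨J, hJ⟩ := (c.eventually_pos_mem x).exists
  -- At stage `J` the point may lie on the top or bottom level; from stage `J + 1` on it is
  -- interior.
  refine ⟨J + 1, fun j hj => ?_⟩
  induction j, hj using Nat.le_induction with
  | base => rfl
  | succ j hj ih =>
    have h := c.pos_mem_interior (Nat.lt_of_succ_le hj) hJ
    rw [← ih, c.shift_succ (c.pos_mem_of_le (Nat.le_of_succ_le hj) hJ)]
    rw [positions, Finset.mem_Ico]
    omega

theorem exists_automorphism : ∃ T : ℝ ≃ᵐ ℝ, MeasurePreserving T volume volume ∧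
    ∀ x, ∀ᶠ j in atTop, T x = c.shift j 1 x :=
  exists_measurableEquiv_eventually_eq (ψ := fun j => c.shift j (-1))
    (fun j => c.measurePreserving_shift j 1) (fun j => c.measurePreserving_shift j (-1))
    (fun j x => by rw [shift_shift, add_neg_cancel, shift_zero])
    (fun j x => by rw [shift_shift, neg_add_cancel, shift_zero])
    (fun x => c.exists_shift_eventually_const x (by norm_num) (by norm_num))
    (fun x => c.exists_shift_eventually_const x (by norm_num) (by norm_num))

/-- The rank-one automorphism defined by cutting and stacking. -/
noncomputable def automorphism : ℝ ≃ᵐ ℝ := c.exists_automorphism.choose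

theorem measurePreserving_automorphism : MeasurePreserving c.automorphism volume volume :=
  c.exists_automorphism.choose_spec.1

theorem automorphism_apply {j : ℕ} {x : ℝ} (hx : c.pos j x ∈ c.positions j)
    (hx' : c.pos j x + 1 < c.N j) : c.automorphism x = c.shift j 1 x := by
  have h : ∀ i ≥ j, c.shift i 1 x = c.shift j 1 x := by
    intro i hi
    induction i, hi using Nat.le_induction with
    | base => rfl
    | succ i hi ih =>
      have hm := c.pos_mem_of_le hi hx
      rw [← ih, c.shift_succ hm]
      rw [positions, Finset.mem_Ico] at hm ⊢
      rcases hi.eq_or_lt with rfl | hi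
      · omega
      · have := c.pos_mem_interior hi hx
        omega
  obtain ⟨i, hi, hi'⟩ :=
    ((c.exists_automorphism.choose_spec.2 x).and (eventually_ge_atTop j)).exists
  exact hi.trans (h i hi')

theorem iterate_automorphism_apply {j : ℕ} {x : ℝ} (hx : c.pos j x ∈ c.positions j) (n : ℕ)
    (hx' : c.pos j x + n < c.N j) : (⇑c.automorphism)^[n] x = c.shift j n x := by
  induction n with
  | zero => exact (c.shift_zero j x).symm
  | succ n ih =>
    rw [Nat.cast_succ] at hx' ⊢
    rw [Function.iterate_succ_apply', ih (by omega), c.automorphism_apply (j := j),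
      shift_shift, add_comm (1 : ℤ)]
    · rw [pos_shift]
      rw [positions, Finset.mem_Ico] at hx ⊢
      omega
    · rw [pos_shift]
      omega

theorem pos_iterate_automorphism {j : ℕ} {x : ℝ} (hx : c.pos j x ∈ c.positions j) (n : ℕ)
    (hx' : c.pos j x + n < c.N j) :
    c.pos j ((⇑c.automorphism)^[n] x) = c.pos j x + n := by
  rw [c.iterate_automorphism_apply hx n hx', pos_shift]

end CuttingStacking

namespace CuttingStacking

variable (c : CuttingStacking)

/-! ### Approximation by unions of levels -/

/-- The union of the cells of stage `j` with index in `K`. -/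
def cells (j : ℕ) (K : Finset ℤ) : Set ℝ := cellIndex (c.scale j) ⁻¹' K

theorem measurableSet_cells (j : ℕ) (K : Finset ℤ) : MeasurableSet (c.cells j K) :=
  measurable_cellIndex _ K.measurableSet

theorem volume_cells (j : ℕ) (K : Finset ℤ) :
    volume (c.cells j K) = K.card * ENNReal.ofReal (1 / c.scale j) := by
  have h : c.cells j K = ⋃ k ∈ K, cellIndex (c.scale j) ⁻¹' {k} := by
    ext x
    simp [cells]
  rw [h, measure_biUnion_finset]
  · simp [volume_cellIndex_preimage_singleton (c.scale_pos j)]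
  · intro k _ l _ hkl
    exact (Set.disjoint_singleton.2 hkl).preimage _
  · exact fun k _ => measurable_cellIndex _ (measurableSet_singleton k)

theorem volume_cells_ne_top (j : ℕ) (K : Finset ℤ) : volume (c.cells j K) ≠ ∞ := by
  rw [volume_cells]
  exact ENNReal.mul_ne_top (ENNReal.natCast_ne_top _) ENNReal.ofReal_ne_top

/-- Squeeze a compact `F ⊆ A` and an open `U ⊇ F` by regularity; once the mesh is finer than a
thickening radius, the cells meeting `F` lie between them. As `F` is bounded, these cells belong to
the tower. -/
theorem eventually_exists_cells {A : Set ℝ} (hA : MeasurableSet A) (hμA : volume A ≠ ∞)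
    {ε : ℝ≥0∞} (hε : 0 < ε) :
    ∀ᶠ j in atTop, ∃ K ⊆ c.positions j, volume (A ∆ c.cells j K) < ε := by
  have hε2 : ε / 2 ≠ 0 := (ENNReal.half_pos hε.ne').ne'
  obtain ⟨F, hFA, hF, hAF⟩ := hA.exists_isCompact_sdiff_lt hμA hε2
  obtain ⟨U, hFU, hU, -, hUF⟩ := hF.measurableSet.exists_isOpen_sdiff_lt
    (hF.measure_lt_top (μ := volume)).ne hε2
  obtain ⟨δ, hδ, hδU⟩ := hF.exists_thickening_subset_open hU hFU
  obtain ⟨M, hM⟩ := hF.isBounded.exists_norm_le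
  obtain ⟨J₁, hJ₁⟩ := exists_nat_gt M
  obtain ⟨J₂, hJ₂⟩ := exists_nat_gt (1 / δ)
  filter_upwards [eventually_ge_atTop J₁, eventually_ge_atTop J₂] with j hj1 hj2
  classical
  refine ⟨(c.positions j).filter fun k => ∃ x ∈ F, cellIndex (c.scale j) x = k,
    Finset.filter_subset _ _, ?_⟩
  set B := c.cells j ((c.positions j).filter fun k => ∃ x ∈ F, cellIndex (c.scale j) x = k)
    with hB
  have hFB : F ⊆ B := by
    intro x hx
    refine Finset.mem_coe.2 (Finset.mem_filter.2 ⟨c.pos_mem.1 (c.pos_mem_of_abs_lt ?_), x, hx, rfl⟩)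
    exact (hM x hx).trans_lt (hJ₁.trans_le (by exact_mod_cast hj1))
  have hBU : B ⊆ U := by
    intro y hy
    rw [hB, cells, Set.mem_preimage, Finset.mem_coe, Finset.mem_filter] at hy
    obtain ⟨-, x, hx, hxy⟩ := hy
    refine hδU (Metric.mem_thickening_iff.2 ⟨x, hx, ?_⟩)
    rw [Real.dist_eq]
    refine (abs_sub_lt_of_cellIndex_eq (c.scale_pos j) hxy.symm).trans_le ?_
    have h0 : (0 : ℝ) < c.scale j := by exact_mod_cast c.scale_pos j
    have h1 : (J₂ : ℝ) ≤ c.scale j := by exact_mod_cast hj2.trans (c.lt_scale j).le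
    rw [div_le_comm₀ h0 hδ]
    exact (hJ₂.trans_le h1).le
  calc volume (A ∆ B) ≤ volume ((A \ F) ∪ (U \ F)) := by
        refine measure_mono ?_
        rintro x (⟨hxA, hxB⟩ | ⟨hxB, hxA⟩)
        · exact Or.inl ⟨hxA, fun h => hxB (hFB h)⟩
        · exact Or.inr ⟨hBU hxB, fun h => hxA (hFA h)⟩
    _ ≤ volume (A \ F) + volume (U \ F) := measure_union_le _ _
    _ < ε / 2 + ε / 2 := ENNReal.add_lt_add hAF hUF
    _ = ε := ENNReal.add_halves ε

/-! ### The tower levels -/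

/-- The level of the `j`-th tower at height `i` above the bottom. -/
def level (j i : ℕ) : Set ℝ := c.pos j ⁻¹' {-(c.N j : ℤ) + i}

theorem level_eq_cells (j i : ℕ) :
    c.level j i = c.cells j {(c.e j).symm (-(c.N j : ℤ) + i)} := by
  ext x
  simp [level, cells, pos, Equiv.eq_symm_apply]

theorem iterate_image_level {j i : ℕ} (hi : i < 2 * c.N j) :
    (⇑c.automorphism)^[i] '' c.level j 0 = c.level j i := by
  have key : ∀ x ∈ c.level j 0, (⇑c.automorphism)^[i] x = c.shift j i x := by
    intro x hx
    have hx' : c.pos j x = -(c.N j : ℤ) + (0 : ℕ) := hx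
    refine c.iterate_automorphism_apply ?_ i ?_
    · rw [positions, Finset.mem_Ico]
      omega
    · omega
  ext y
  constructor
  · rintro ⟨x, hx, rfl⟩
    rw [key x hx]
    have hx' : c.pos j x = -(c.N j : ℤ) + (0 : ℕ) := hx
    change c.pos j _ = _
    rw [pos_shift, hx']
    simp
  · intro hy
    have hy' : c.pos j y = -(c.N j : ℤ) + i := hy
    have h0 : c.shift j (-i) y ∈ c.level j 0 := by
      change c.pos j _ = _
      rw [pos_shift, hy']
      simp
    exact ⟨_, h0, by rw [key _ h0, shift_shift, add_neg_cancel, shift_zero]⟩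

theorem cells_eq_iUnion_level {j : ℕ} {K : Finset ℤ} (hK : K ⊆ c.positions j) :
    ∃ I ⊆ Finset.range (2 * c.N j), c.cells j K = ⋃ i ∈ I, c.level j i := by
  refine ⟨(Finset.range (2 * c.N j)).filter fun i => (c.e j).symm (-(c.N j : ℤ) + i) ∈ K,
    Finset.filter_subset _ _, ?_⟩
  ext x
  simp only [Set.mem_iUnion, Finset.mem_filter, Finset.mem_range]
  constructor
  · intro hx
    have h1 : c.pos j x ∈ c.positions j := c.pos_mem.2 (hK hx)
    rw [positions, Finset.mem_Ico] at h1
    obtain ⟨i, hi⟩ := Int.eq_ofNat_of_zero_le (show 0 ≤ c.pos j x + c.N j by omega)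
    have h2 : c.pos j x = -(c.N j : ℤ) + i := by omega
    refine ⟨i, ⟨by omega, ?_⟩, h2⟩
    rw [← h2, pos, Equiv.symm_apply_apply]
    exact hx
  · rintro ⟨i, ⟨-, hi⟩, hx⟩
    have h2 : c.pos j x = -(c.N j : ℤ) + i := hx
    rw [← h2, pos, Equiv.symm_apply_apply] at hi
    exact hi

theorem isRankOne_automorphism : IsRankOne c.automorphism volume := by
  refine ⟨fun j => c.level j 0, fun j => 2 * c.N j, fun j => ?_, fun j k hk l hl hkl => ?_,
    fun A hA hμA ε hε => ?_⟩
  · simp only [level_eq_cells]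
    exact ⟨c.measurableSet_cells _ _, (c.volume_cells_ne_top _ _).lt_top⟩
  · rw [c.iterate_image_level hk, c.iterate_image_level hl]
    refine Disjoint.preimage _ (Set.disjoint_singleton.2 ?_)
    omega
  · filter_upwards [c.eventually_exists_cells hA hμA.ne hε] with j ⟨K, hK, hlt⟩
    obtain ⟨I, hI, hKI⟩ := c.cells_eq_iUnion_level hK
    refine ⟨I, hI, ?_⟩
    rw [hKI] at hlt
    convert hlt using 6 with i hi
    exact c.iterate_image_level (Finset.mem_range.1 (hI hi))

/-! ### Rigidity along the distances between the columns -/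

/-- Only points of the last column, with digit `r j - 1`, can fail to return to their level; every
other digit `d` becomes `d + 1`. -/
theorem volume_cells_diff_preimage_le {j : ℕ} {K : Finset ℤ} (hK : K ⊆ c.positions j) :
    volume (c.cells j K \ (⇑c.automorphism)^[c.a j] ⁻¹' c.cells j K) ≤
      volume (c.cells j K) / c.r j := by
  have hr : (0 : ℤ) < c.r j := by exact_mod_cast c.r_pos j
  have hsub : c.cells j K \ (⇑c.automorphism)^[c.a j] ⁻¹' c.cells j K ⊆
      c.cells (j + 1) (K.image fun k => c.r j * k + (c.r j - 1)) := by
    rintro x ⟨hx, hxT⟩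
    obtain ⟨d, hd, hdr, hxd⟩ := c.exists_digit j x
    have hxK : cellIndex (c.scale j) x ∈ K := hx
    have hxp := c.pos_mem.2 (hK hx)
    refine Finset.mem_coe.2 (Finset.mem_image.2 ⟨_, hxK, ?_⟩)
    rw [hxd]
    by_contra hne
    have hd1 : d + 1 < c.r j := by omega
    have hps := c.pos_succ hxp hd hdr hxd
    have hN : (c.N j : ℤ) + c.r j * c.a j < c.N (j + 1) := by exact_mod_cast c.lt_N j
    have hle : (d + 1) * (c.a j : ℤ) ≤ c.r j * c.a j := by gcongr
    have hxp' := hxp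
    rw [positions, Finset.mem_Ico] at hxp'
    have h1 := c.pos_iterate_automorphism (c.pos_mem_of_le (Nat.le_succ j) hxp) (c.a j)
      (by rw [hps]; linarith)
    have h2 : c.pos (j + 1) ((⇑c.automorphism)^[c.a j] x) =
        c.e (j + 1) (c.r j * cellIndex (c.scale j) x + (d + 1)) := by
      rw [h1, hps, c.e_succ j _ (hK hx) (d + 1) (by omega) hd1, pos]
      ring
    have h3 : cellIndex (c.scale (j + 1)) ((⇑c.automorphism)^[c.a j] x) =
        c.r j * cellIndex (c.scale j) x + (d + 1) := (c.e (j + 1)).injective h2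
    refine hxT ?_
    change cellIndex (c.scale j) _ ∈ K
    rwa [← cellIndex_mul_ediv (R := c.scale j) (c.r_pos j), ← scale_succ, h3, add_comm,
      Int.add_mul_ediv_left _ _ hr.ne', Int.ediv_eq_zero_of_lt (by omega) hd1, zero_add]
  refine (measure_mono hsub).trans ?_
  rw [volume_cells, volume_cells, scale_succ, mul_div_assoc,
    ← ENNReal.ofReal_natCast (c.r j), ← ENNReal.ofReal_div_of_pos (by exact_mod_cast c.r_pos j),
    div_div, Nat.cast_mul]
  gcongr ?_ * _
  exact_mod_cast Finset.card_image_le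

theorem tendsto_volume_diff_preimage (hr : Tendsto c.r atTop atTop) {A : Set ℝ}
    (hA : MeasurableSet A) (hμA : volume A ≠ ∞) :
    Tendsto (fun j => volume.real (A \ (⇑c.automorphism)^[c.a j] ⁻¹' A)) atTop (𝓝 0) := by
  refine (ENNReal.tendsto_toReal ENNReal.zero_ne_top).comp (ENNReal.tendsto_nhds_zero.2 ?_)
  intro ε hε
  rcases eq_or_ne ε ∞ with rfl | hεtop
  · simp
  have hε3 : 0 < ε / 3 := ENNReal.div_pos hε.ne' (by norm_num)
  -- The approximating set varies with `j`, but its measure stays below `volume A + ε / 3`.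
  have hlim : Tendsto (fun j => (volume A + ε / 3) / (c.r j : ℝ≥0∞)) atTop (𝓝 0) := by
    have h := ENNReal.Tendsto.const_mul (a := volume A + ε / 3)
      (ENNReal.tendsto_inv_nat_nhds_zero.comp hr)
      (Or.inr (ENNReal.add_ne_top.2 ⟨hμA, (ENNReal.div_lt_top hεtop (by norm_num)).ne⟩))
    simpa [div_eq_mul_inv] using h
  filter_upwards [c.eventually_exists_cells hA hμA hε3, ENNReal.tendsto_nhds_zero.1 hlim _ hε3]
    with j ⟨K, hK, hlt⟩ hj
  set B := c.cells j K
  set f := (⇑c.automorphism)^[c.a j]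
  have hf : MeasurePreserving f volume volume := c.measurePreserving_automorphism.iterate _
  have hBm : MeasurableSet B := c.measurableSet_cells j K
  have h1 : volume (A \ B) ≤ ε / 3 := (measure_mono Set.subset_union_left).trans hlt.le
  have h2 : volume (B \ A) ≤ ε / 3 := (measure_mono Set.subset_union_right).trans hlt.le
  have h3 : volume B ≤ volume A + ε / 3 := by
    calc volume B ≤ volume (A ∪ (B \ A)) := measure_mono (by simp)
      _ ≤ volume A + volume (B \ A) := measure_union_le _ _
      _ ≤ _ := by gcongr
  calc volume (A \ f ⁻¹' A) ≤ volume ((A \ B) ∪ (B \ f ⁻¹' B) ∪ f ⁻¹' (B \ A)) := by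
        refine measure_mono ?_
        rintro x ⟨hxA, hxf⟩
        by_cases hxB : x ∈ B
        · by_cases hfx : f x ∈ B
          · exact Or.inr ⟨hfx, hxf⟩
          · exact Or.inl (Or.inr ⟨hxB, hfx⟩)
        · exact Or.inl (Or.inl ⟨hxA, hxB⟩)
    _ ≤ volume (A \ B) + volume (B \ f ⁻¹' B) + volume (f ⁻¹' (B \ A)) :=
        (measure_union_le _ _).trans (by gcongr; exact measure_union_le _ _)
    _ ≤ ε / 3 + ε / 3 + ε / 3 := by
        rw [hf.measure_preimage (hBm.diff hA).nullMeasurableSet]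
        gcongr
        refine (c.volume_cells_diff_preimage_le hK).trans (le_trans ?_ hj)
        gcongr
    _ = ε := ENNReal.add_thirds ε

/-! ### Mixing along times that separate the columns -/

/-- A point going from column `d` back to column `d'` would change its stage-`j` position by `m + (d
- d') * a j`, whereas two positions in the tower differ by less than `2 * N j`. The bound `hmN`
keeps the orbit inside the next tower. -/
theorem pos_iterate_notMem {j m : ℕ}
    (hm : ∀ l : ℤ, |l| < c.r j → 2 * (c.N j : ℤ) ≤ |m + l * c.a j|)
    (hmN : c.N j + c.r j * c.a j + m < c.N (j + 1)) {x : ℝ} (hx : c.pos j x ∈ c.positions j) :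
    c.pos j ((⇑c.automorphism)^[m] x) ∉ c.positions j := by
  intro hy
  set y := (⇑c.automorphism)^[m] x
  obtain ⟨d, hd, hdr, hxd⟩ := c.exists_digit j x
  obtain ⟨d', hd', hdr', hyd⟩ := c.exists_digit j y
  have h1 := c.pos_succ hx hd hdr hxd
  have h2 := c.pos_succ hy hd' hdr' hyd
  have hN : (c.N j : ℤ) + c.r j * c.a j + m < c.N (j + 1) := by exact_mod_cast hmN
  have hle : d * (c.a j : ℤ) ≤ c.r j * c.a j := by gcongr
  have hx' := hx
  rw [positions, Finset.mem_Ico] at hx' hy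
  have h3 : c.pos (j + 1) y = c.pos (j + 1) x + m :=
    c.pos_iterate_automorphism (c.pos_mem_of_le (Nat.le_succ j) hx) m (by rw [h1]; linarith)
  have h4 := hm (d - d') (abs_lt.2 ⟨by omega, by omega⟩)
  have h5 : (m : ℤ) + (d - d') * c.a j = c.pos j y - c.pos j x := by linarith
  rw [h5, le_abs] at h4
  omega

theorem tendsto_volume_preimage_inter {m : ℕ → ℕ}
    (hm : ∀ j, ∀ l : ℤ, |l| < c.r j → 2 * (c.N j : ℤ) ≤ |m j + l * c.a j|)
    (hmN : ∀ j, c.N j + c.r j * c.a j + m j < c.N (j + 1)) {A A' : Set ℝ}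
    (hA : MeasurableSet A) (hμA : volume A ≠ ∞) (hA' : MeasurableSet A') (hμA' : volume A' ≠ ∞) :
    Tendsto (fun j => volume.real ((⇑c.automorphism)^[m j] ⁻¹' A ∩ A')) atTop (𝓝 0) := by
  refine (ENNReal.tendsto_toReal ENNReal.zero_ne_top).comp (ENNReal.tendsto_nhds_zero.2 ?_)
  intro ε hε
  have hε2 : 0 < ε / 2 := ENNReal.half_pos hε.ne'
  filter_upwards [c.eventually_exists_cells hA hμA hε2, c.eventually_exists_cells hA' hμA' hε2]
    with j ⟨K, hK, hlt⟩ ⟨K', hK', hlt'⟩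
  set f := (⇑c.automorphism)^[m j]
  have hf : MeasurePreserving f volume volume := c.measurePreserving_automorphism.iterate _
  calc volume (f ⁻¹' A ∩ A') ≤ volume (f ⁻¹' (A \ c.cells j K) ∪ (A' \ c.cells j K')) := by
        refine measure_mono ?_
        rintro x ⟨hfx, hx⟩
        by_cases hxK : x ∈ c.cells j K'
        · refine Or.inl ⟨hfx, fun hfK => ?_⟩
          exact c.pos_iterate_notMem (hm j) (hmN j) (c.pos_mem.2 (hK' hxK))
            (c.pos_mem.2 (hK hfK))
        · exact Or.inr ⟨hx, hxK⟩
    _ ≤ volume (f ⁻¹' (A \ c.cells j K)) + volume (A' \ c.cells j K') := measure_union_le _ _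
    _ ≤ ε / 2 + ε / 2 := by
        rw [hf.measure_preimage (hA.diff (c.measurableSet_cells j K)).nullMeasurableSet]
        gcongr
        · exact (measure_mono Set.subset_union_left).trans hlt.le
        · exact (measure_mono Set.subset_union_left).trans hlt'.le
    _ = ε := ENNReal.add_halves ε

end CuttingStacking

/-! ### Choice of the parameters and conclusion -/

/-- A rank-one automorphism of the line that is rigid along `a` and mixing along `m`. -/
theorem exists_rankOne_rigid_mixing {r N a m : ℕ → ℕ} (hr : ∀ j, 2 ≤ r j)
    (hr' : Tendsto r atTop atTop) (ha : ∀ j, 2 * N j ≤ a j)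
    (hm : ∀ j, ∀ l : ℤ, |l| < r j → 2 * (N j : ℤ) ≤ |m j + l * a j|)
    (hN : ∀ j, N j + r j * a j + m j < N (j + 1))
    (hN' : ∀ j, j * ∏ i ∈ Finset.range j, r i ≤ N j)
    (ha_mono : StrictMono a) (hm_mono : StrictMono m) :
    ∃ (T : ℝ ≃ᵐ ℝ) (hT : MeasurePreserving T volume volume),
      Ergodic T volume ∧ IsRankOne T volume ∧
      PowTendstoIdAlong (koopman hT) (Set.range a) ∧
      PowTendstoZeroAlong (koopman hT) (Set.range m) := by
  obtain ⟨c, rfl, rfl, rfl⟩ := exists_cuttingStacking hr ha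
    (fun j => (Nat.le_add_right _ _).trans_lt (hN j)) hN'
  exact ⟨c.automorphism, c.measurePreserving_automorphism,
    c.isRankOne_automorphism.ergodic c.measurePreserving_automorphism, c.isRankOne_automorphism,
    powTendstoIdAlong_koopman _ fun A hA hμA => tendsto_along_range ha_mono
      (c.tendsto_volume_diff_preimage hr' hA hμA),
    powTendstoZeroAlong_koopman _ fun A B hA hμA hB hμB => tendsto_along_range hm_mono
      (c.tendsto_volume_preimage_inter hm hN hA hμA hB hμB)⟩

/-- Times `c ∈ C'` and `d ∈ D'` and tower heights `N` such that both rigidity along `c` with mixing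
along `d` and rigidity along `d` with mixing along `c` can be arranged. -/
theorem exists_interlaced_times {C' D' : Set ℕ} (hC' : C'.Infinite) (hD' : D'.Infinite)
    (r : ℕ → ℕ) :
    ∃ c d N : ℕ → ℕ, (∀ j, c j ∈ C') ∧ (∀ j, d j ∈ D') ∧ (∀ j, 2 * N j ≤ c j) ∧
      (∀ j, r j * c j + 2 * N j ≤ d j) ∧ (∀ j, c j ≤ d j) ∧
      (∀ j, N j + r j * (c j + d j) + c j + d j < N (j + 1)) ∧
      ∀ j, j * ∏ i ∈ Finset.range j, r i ≤ N j := by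
  choose gC hgC hltC using fun n => hC'.exists_gt n
  choose gD hgD hltD using fun n => hD'.exists_gt n
  let c : ℕ → ℕ := fun n => gC (2 * n)
  -- The threshold adds up the two lower bounds required of `d`: `r j * c n + 2 * n` and `c n`.
  let d : ℕ → ℕ → ℕ := fun j n => gD (r j * c n + 2 * n + c n)
  let N : ℕ → ℕ := fun j => Nat.rec 0 (fun j n => n + r j * (c n + d j n) + c n + d j n + 1 +
    (j + 1) * ∏ i ∈ Finset.range (j + 1), r i) j
  have hN : ∀ j, N (j + 1) = N j + r j * (c (N j) + d j (N j)) + c (N j) + d j (N j) + 1 +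
    (j + 1) * ∏ i ∈ Finset.range (j + 1), r i := fun _ => rfl
  refine ⟨fun j => c (N j), fun j => d j (N j), N, fun j => hgC _, fun j => hgD _,
    fun j => (hltC _).le, fun j => ?_, fun j => ?_, fun j => ?_, fun j => ?_⟩
  · exact (Nat.le_add_right _ _).trans (hltD _).le
  · exact (Nat.le_add_left _ _).trans (hltD _).le
  · rw [hN]
    dsimp only
    omega
  · cases j with
    | zero => simp
    | succ j => rw [hN]; omega

theorem mainTheorem9 (C' D' : Set ℕ) (hC' : C'.Infinite) (hD' : D'.Infinite) :
    ∃ C D : Set ℕ, C ⊆ C' ∧ D ⊆ D' ∧ C.Infinite ∧ D.Infinite ∧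
      ∃ (X : Type) (_ : MeasurableSpace X) (μ : Measure X),
        StandardBorelSpace X ∧ SigmaFinite μ ∧ NullSingletonClass μ ∧ μ Set.univ = ∞ ∧
        ∃ (S T : X ≃ᵐ X) (hS : MeasurePreserving S μ μ) (hT : MeasurePreserving T μ μ),
          Ergodic S μ ∧ Ergodic T μ ∧ IsRankOne S μ ∧ IsRankOne T μ ∧
          PowTendstoZeroAlong (koopman hS) C ∧ PowTendstoIdAlong (koopman hT) C ∧
          PowTendstoIdAlong (koopman hS) D ∧ PowTendstoZeroAlong (koopman hT) D := by
  let r : ℕ → ℕ := fun j => j + 2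
  obtain ⟨c, d, N, hc, hd, hNc, hcd, hcd', hN, hN'⟩ := exists_interlaced_times hC' hD' r
  have hr : ∀ j, 2 ≤ r j := fun j => Nat.le_add_left 2 j
  have hr' : Tendsto r atTop atTop := tendsto_add_atTop_nat 2
  -- Both times of stage `j` are below `N (j + 1)`, hence below both times of stage `j + 1`.
  have hc_mono : StrictMono c := strictMono_nat_of_lt_succ fun j => by
    have h1 := hN j
    have h2 := hNc (j + 1)
    omega
  have hd_mono : StrictMono d := strictMono_nat_of_lt_succ fun j => by
    have h1 := hN j
    have h2 := hNc (j + 1)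
    have h3 := hcd' (j + 1)
    omega
  obtain ⟨T, hT, hTe, hTr, hTid, hT0⟩ := exists_rankOne_rigid_mixing (r := r) (N := N) (a := c)
    (m := d) hr hr' hNc
    -- Spacing `c`, time `d`: even the most negative `l * c j` leaves at least `2 * N j`, because `d
    -- j ≥ r j * c j + 2 * N j`.
    (by
      intro j l hl
      have h1 : (r j : ℤ) * c j + 2 * N j ≤ d j := by exact_mod_cast hcd j
      have h2 : -((r j : ℤ) * c j) ≤ l * c j := by
        rw [← neg_mul]
        gcongr
        exact (abs_lt.1 hl).1.le
      exact (by linarith : 2 * (N j : ℤ) ≤ d j + l * c j).trans (le_abs_self _))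
    (fun j => by have := hN j; rw [mul_add] at this; omega) hN' hc_mono hd_mono
  obtain ⟨S, hS, hSe, hSr, hSid, hS0⟩ := exists_rankOne_rigid_mixing (r := r) (N := N) (a := d)
    (m := c) hr hr' (fun j => (hNc j).trans (hcd' j))
    -- Spacing `d`, time `c`: for `l ≥ 0` the bound `c j ≥ 2 * N j` suffices; for `l < 0` the
    -- modulus is at least `d j - c j`, and `r j ≥ 2` makes this large enough.
    (by
      intro j l hl
      have h0 : 2 * (N j : ℤ) ≤ c j := by exact_mod_cast hNc j
      have h1 : (r j : ℤ) * c j + 2 * N j ≤ d j := by exact_mod_cast hcd j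
      have h2 : 2 * (c j : ℤ) ≤ r j * c j := by
        gcongr
        exact_mod_cast hr j
      rw [le_abs]
      rcases le_or_gt 0 l with h | h
      · left
        have : 0 ≤ l * (d j : ℤ) := by positivity
        linarith
      · right
        have : l * (d j : ℤ) ≤ -1 * d j := by gcongr; omega
        linarith)
    (fun j => by have := hN j; rw [mul_add] at this; omega) hN' hd_mono hc_mono
  exact ⟨Set.range c, Set.range d, Set.range_subset_iff.2 hc, Set.range_subset_iff.2 hd,
    Set.infinite_range_of_injective hc_mono.injective,
    Set.infinite_range_of_injective hd_mono.injective,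
    ℝ, inferInstance, volume, inferInstance, inferInstance, inferInstance, Real.volume_univ,
    S, T, hS, hT, hSe, hTe, hSr, hTr, hS0, hTid, hSid, hT0⟩
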